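/- Let $G$ be a second countable locally compact Hausdorff group and $\Gamma\subset G$ a closed subgroup, with fixed left Haar measures $\mu_G$, $\mu_\Gamma$ and modular functions $\Delta_G$, $\Delta_\Gamma$, where $\int_G f(xy)\,d\mu_G(x)=\Delta_G(y^{-1})\int_G f(x)\,d\mu_G(x)$ for $f\in L^1(G,\mu_G)$ and $y\in G$, and similarly for $\Gamma$. Let $\tau\colon G/\Gamma\to G$ be a Borel measurable map with $\tau(x\Gamma)\in x\Gamma$ for all $x\in G$, such that $\tau(K)$ has compact closure in $G$ for every compact $K\subset G/\Gamma$. Let $\varepsilon\colon\Gamma\backslash G\to G/\Gamma$ be the homeomorphism $\varepsilon(\Gamma x)=x^{-1}\Gamma$, and let $\gamma\colon\Gamma\backslash G\to G$ be the Borel section $\gamma(\Gamma x)=\tau(x^{-1}\Gamma)^{-1}$. Theorem. There is a unique positive regular Borel measure $\mu_{\Gamma\backslash G}$ on $\Gamma\backslash G$ such that $$\int_G f(x)\,d\mu_G(x)=\int_{\Gamma\backslash G}\int_\Gamma f(\xi\gamma(\Gamma x))\,d\mu_\Gamma(\xi)\,d\mu_{\Gamma\backslash G}(\Gamma x)\qquad\text{for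 all } f\in L^1(G,\mu_G).$$ Moreover, for $f\in L^1(G,\mu_G)$, the function $\xi\mapsto f(\xi\gamma(\Gamma x))$ belongs to $L^1(\Gamma,\mu_\Gamma)$ for $\mu_{\Gamma\backslash G}$-a.e. $\Gamma x$, and $\Gamma x\mapsto\int_\Gamma f(\xi\gamma(\Gamma x))\,d\mu_\Gamma(\xi)$ is $\mu_{\Gamma\backslash G}$-integrable (in particular $\mu_{\Gamma\backslash G}$-measurable), and Borel measurable if $f$ is. Finally, let $\rho\colon G\to(0,\infty)$ be a rho function for $(G,\Gamma)$, i.e. a continuous function with $\rho(x\xi)=\rho(x)\,\Delta_\Gamma(\xi)/\Delta_G(\xi)$ for $x\in G$, $\xi\in\Gamma$. Then there is a unique positive regular Borel measure $\mu_{G/\Gamma}$ on $G/\Gamma$ with $$\int_G f(x)\rho(x)\,d\mu_G(x)=\int_{G/\Gamma}\int_\Gamma f(x\xi)\,d\mu_\Gamma(\xi)\,d\mu_{G/\Gamma}(x\Gamma)\qquad\text{for all } f\in L^1(G,\rho\,\mu_G),$$ and for every $f\in L^1(\Gamma\backslash G,\mu_{\Gamma\backslash G})$ the integrand on the right below is $\mu_{G/\Gamma}$-integrable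 and $$\int_{\Gamma\backslash G}f(\Gamma x)\,d\mu_{\Gamma\backslash G}(\Gamma x)=\int_{G/\Gamma}f(\varepsilon^{-1}(x\Gamma))\,\frac{1}{\rho(\tau(x\Gamma))\,\Delta_G(\tau(x\Gamma))}\,d\mu_{G/\Gamma}(x\Gamma).$$ -/

import Mathlib

open MeasureTheory

noncomputable section

namespace CosetWeil

/-- The space `Γ \ G` of right cosets `Γ x`; it carries the quotient topology and the
quotient `σ`-algebra (which is the Borel `σ`-algebra, see `borelSpace_rightCosets`). -/
abbrev RightCosets {G : Type*} [Group G] (Γ : Subgroup G) : Type _ :=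
  Quotient (QuotientGroup.rightRel Γ)

theorem locallyCompactSpace_subgroup {G : Type*} [Group G] [TopologicalSpace G]
    [LocallyCompactSpace G] (Γ : Subgroup G) (hΓ : IsClosed (Γ : Set G)) : LocallyCompactSpace Γ :=
  hΓ.isClosedEmbedding_subtypeVal.locallyCompactSpace

section Topology

variable {G : Type*} [Group G] [TopologicalSpace G] [IsTopologicalGroup G]

/-- The homeomorphism `ε : Γ \ G → G / Γ`, `ε (Γ x) = x⁻¹ Γ`. -/
def cosetInv (Γ : Subgroup G) : RightCosets Γ ≃ₜ G ⧸ Γ where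
  toEquiv := QuotientGroup.quotientRightRelEquivQuotientLeftRel Γ
  continuous_toFun := continuous_quot_lift _ (continuous_quot_mk.comp continuous_inv)
  continuous_invFun := continuous_quot_lift _ (continuous_quot_mk.comp continuous_inv)

theorem cosetInv_mk (Γ : Subgroup G) (x : G) :
    cosetInv Γ (Quotient.mk (QuotientGroup.rightRel Γ) x) = (QuotientGroup.mk x⁻¹ : G ⧸ Γ) := rfl

theorem t2Space_leftCosets [T2Space G] (Γ : Subgroup G) (hΓ : IsClosed (Γ : Set G)) :
    T2Space (G ⧸ Γ) := by
  have := hΓ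
  infer_instance

theorem polishSpace_group [T2Space G] [LocallyCompactSpace G] [SecondCountableTopology G] :
    PolishSpace G := by
  let : UniformSpace G := IsTopologicalGroup.rightUniformSpace G
  have : IsRightUniformGroup G := { uniformity_eq := rfl }
  have : CompleteSpace G := IsRightUniformGroup.completeSpace_of_weaklyLocallyCompactSpace
  have : (uniformity G).IsCountablyGenerated := by
    change (Filter.comap _ (nhds (1 : G))).IsCountablyGenerated
    infer_instance
  have : TopologicalSpace.IsCompletelyMetrizableSpace G := inferInstance
  infer_instance

variable [MeasurableSpace G] [BorelSpace G] [T2Space G] [LocallyCompactSpace G]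
  [SecondCountableTopology G]

theorem borelSpace_leftCosets (Γ : Subgroup G) (hΓ : IsClosed (Γ : Set G)) :
    BorelSpace (G ⧸ Γ) := by
  have := t2Space_leftCosets Γ hΓ
  have : PolishSpace G := polishSpace_group
  exact ⟨QuotientGroup.continuous_mk.map_eq_borel QuotientGroup.mk_surjective⟩

theorem borelSpace_rightCosets (Γ : Subgroup G) (hΓ : IsClosed (Γ : Set G)) :
    BorelSpace (RightCosets Γ) := by
  have := t2Space_leftCosets Γ hΓ
  have : PolishSpace G := polishSpace_group
  have : T2Space (RightCosets Γ) := (cosetInv Γ).symm.t2Space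
  have : SecondCountableTopology (RightCosets Γ) := (cosetInv Γ).secondCountableTopology
  exact ⟨continuous_quotient_mk'.map_eq_borel Quotient.mk_surjective⟩

end Topology

section Modular

variable {G : Type*} [Group G] [TopologicalSpace G] [IsTopologicalGroup G]
  [LocallyCompactSpace G]

/-- The modular function `Δ`, normalised by `∫ f (x y) dx = Δ (y⁻¹) ∫ f (x) dx` for the left Haar
measure `dx`. Mathlib's `modularCharacter` is its inverse: `∫ f (x y) dx = modularCharacter y ∫ f`. -/
def modularFunction (x : G) : ℝ := (Measure.modularCharacter (x⁻¹) : NNReal)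

theorem integral_mul_right_eq [MeasurableSpace G] [BorelSpace G] [SecondCountableTopology G]
    (μ : Measure G) [μ.IsHaarMeasure] (f : G → ℂ) (y : G) :
    ∫ x, f (x * y) ∂μ = (modularFunction y⁻¹ : ℂ) * ∫ x, f x ∂μ := by
  have h := Measure.map_right_mul_eq_modularCharacterFun_smul μ y
  have h2 : ∫ x, f (x * y) ∂μ = ∫ x, f x ∂(μ.map (· * y)) :=
    ((MeasurableEquiv.mulRight y).measurableEmbedding.integral_map f).symm
  rw [h2, h, integral_smul_nnreal_measure, modularFunction, inv_inv, NNReal.smul_def,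
    Complex.real_smul]
  rfl

end Modular

variable {G : Type*} [Group G] [TopologicalSpace G] [IsTopologicalGroup G]
  [MeasurableSpace G] [BorelSpace G]

/-- A Borel section `τ : G / Γ → G` sending compact sets to sets with compact closure. -/
structure IsProperBorelSection (Γ : Subgroup G) (τ : G ⧸ Γ → G) : Prop where
  measurable : Measurable τ
  section_eq : ∀ c : G ⧸ Γ, (QuotientGroup.mk (τ c) : G ⧸ Γ) = c
  isCompact_closure_image : ∀ K : Set (G ⧸ Γ), IsCompact K → IsCompact (closure (τ '' K))

/-- The section `γ (Γ x) = (τ (x⁻¹ Γ))⁻¹` of `Γ \ G` attached to a section `τ` of `G / Γ`. -/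
def rightSection (Γ : Subgroup G) (τ : G ⧸ Γ → G) (c : RightCosets Γ) : G :=
  (τ (cosetInv Γ c))⁻¹

/-- The modular function `Δ_Γ` of a closed subgroup `Γ` of `G`. -/
def subgroupModularFunction [LocallyCompactSpace G] (Γ : Subgroup G) (hΓ : IsClosed (Γ : Set G))
    (ξ : Γ) : ℝ :=
  haveI : LocallyCompactSpace Γ := locallyCompactSpace_subgroup Γ hΓ
  modularFunction ξ

/-- A rho function for `(G, Γ)`: continuous, positive, with
`ρ (x ξ) = ρ (x) Δ_Γ (ξ) / Δ_G (ξ)` for `x ∈ G`, `ξ ∈ Γ`. -/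
structure IsRhoFunction [LocallyCompactSpace G] (Γ : Subgroup G) (hΓ : IsClosed (Γ : Set G))
    (ρ : G → ℝ) : Prop where
  continuous : Continuous ρ
  pos : ∀ x, 0 < ρ x
  map_mul : ∀ (x : G) (ξ : Γ),
    ρ (x * ξ) = ρ x * (subgroupModularFunction Γ hΓ ξ / modularFunction (ξ : G))

/-- The function `x Γ ↦ ∫_Γ f (x ξ) dξ` on `G / Γ`. The representative is immaterial, see
`leftFiberIntegral_mk`. -/
def leftFiberIntegral (Γ : Subgroup G) (μΓ : Measure Γ) (f : G → ℂ) (c : G ⧸ Γ) : ℂ :=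
  ∫ ξ : Γ, f (Quotient.out c * ξ) ∂μΓ

theorem leftFiberIntegral_mk (Γ : Subgroup G) (μΓ : Measure Γ) [μΓ.IsMulLeftInvariant]
    (f : G → ℂ) (x : G) :
    leftFiberIntegral Γ μΓ f (QuotientGroup.mk x) = ∫ ξ : Γ, f (x * ξ) ∂μΓ := by
  obtain ⟨η, hη⟩ := QuotientGroup.mk_out_eq_mul Γ x
  have h := integral_mul_left_eq_self (μ := μΓ) (fun ξ : Γ => f (x * ξ)) η
  rw [← h]
  unfold leftFiberIntegral
  refine integral_congr_ae (Filter.Eventually.of_forall fun ξ => ?_)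
  change f (Quotient.out (QuotientGroup.mk x : G ⧸ Γ) * ξ) = f (x * ((η * ξ : Γ) : G))
  rw [hη, Subgroup.coe_mul, mul_assoc]

/-- `ν` is the quasi-invariant measure `μ_{G/Γ}` of the rho function `ρ`: the regular Borel measure
with `∫_G f ρ = ∫_{G/Γ} ∫_Γ f (x ξ) dξ dν (x Γ)` for all `f` for which `f ρ` is integrable. -/
structure IsRhoMeasure (Γ : Subgroup G) (μG : Measure G) (μΓ : Measure Γ) (ρ : G → ℝ)
    (ν : Measure (G ⧸ Γ)) : Prop where
  regular : ν.Regular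
  integral_eq : ∀ f : G → ℂ, Integrable (fun x => f x * (ρ x : ℂ)) μG →
    ∫ x, f x * (ρ x : ℂ) ∂μG = ∫ c, leftFiberIntegral Γ μΓ f c ∂ν

/-- The function `Γ x ↦ ∫_Γ f (ξ γ (Γ x)) dξ` on `Γ \ G`. -/
def rightFiberIntegral (Γ : Subgroup G) (μΓ : Measure Γ) (γ : RightCosets Γ → G) (f : G → ℂ)
    (c : RightCosets Γ) : ℂ :=
  ∫ ξ : Γ, f (ξ * γ c) ∂μΓ

/-- `μ` is a regular Borel measure on `Γ \ G` with
`∫_G f = ∫_{Γ\G} ∫_Γ f (ξ γ (Γ x)) dξ dμ (Γ x)` for all `f ∈ L¹(G)`. -/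
structure IsRightWeilMeasure (Γ : Subgroup G) (μG : Measure G) (μΓ : Measure Γ)
    (γ : RightCosets Γ → G) (μ : Measure (RightCosets Γ)) : Prop where
  regular : μ.Regular
  integral_eq : ∀ f : G → ℂ, Integrable f μG →
    ∫ x, f x ∂μG = ∫ c, rightFiberIntegral Γ μΓ γ f c ∂μ

end CosetWeil

end

/-! The section splits `G` as a Borel space: `(c, ξ) ↦ ξ γ(c)` is a bijection from `Γ\G × Γ` onto
`G`, inverse to `x ↦ (Γx, rightCoord x)`, and left translation by `Γ` moves only the second
coordinate. For `B` inside a compact set, `E ↦ μG (rightBox B E)` is therefore left invariant on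
`Γ`. Properness of `τ` makes it finite on compacts, so it is a multiple of `μΓ`
(`measure_rightBox_mul`). Hence `μG` is the image of a product `μ × μΓ` (`exists_map_prod_eq`), and
Fubini gives the integral formula and the integrability claims. Uniqueness follows by testing on
indicators of boxes, whose fibre integrals are multiples of indicators of `B`.

The passage to `G/Γ` is inversion. With `D = modularCharacter = Δ⁻¹`, Haar measure satisfies `∫ D(x)
f(x⁻¹) = ∫ f`. Applying this on both `G` and `Γ` turns `ξ γ(c)` into `τ(ε c) ξ⁻¹`; the rho identity
cancels the modular factors that depend on `ξ`, and what remains is the density `ρ(τ) Δ_G(τ)`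
against the image of `μ` under `ε` (`measurePreserving_section_mul`). Dividing by this density is
the last formula. -/

noncomputable section

namespace CosetWeil

open Measure Set
open scoped ENNReal NNReal

/-! ### The modular character and the inversion formula for Haar measure. -/

section Modular

variable {G : Type*} [Group G] [TopologicalSpace G] [IsTopologicalGroup G]
  [LocallyCompactSpace G]

theorem modularCharacter_mul_inv (g : G) :
    (modularCharacter g : ℝ≥0) * modularCharacter g⁻¹ = 1 := by
  rw [← map_mul, mul_inv_cancel, map_one]

theorem modularFunction_pos (x : G) : 0 < modularFunction x :=
  NNReal.coe_pos.2 (modularCharacterFun_pos _)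

variable [SecondCountableTopology G] [MeasurableSpace G] [BorelSpace G]

theorem lintegral_mul_right_eq_modularCharacter (μ : Measure G) [μ.IsHaarMeasure]
    {f : G → ℝ≥0∞} (hf : Measurable f) (g : G) :
    ∫⁻ x, f (x * g) ∂μ = modularCharacter g * ∫⁻ x, f x ∂μ := by
  have h := map_right_mul_eq_modularCharacterFun_smul μ g
  have h2 : ∫⁻ x, f (x * g) ∂μ = ∫⁻ x, f x ∂(μ.map (· * g)) :=
    (lintegral_map hf (measurable_mul_const g)).symm
  rw [h2, h, lintegral_smul_measure]
  rfl

/-- For a fixed open `V` of finite positive measure, `D(g)` is the ratio of `∫ 1_V(xg) dx` to the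
measure of `V`, and a parametrised integral of a jointly measurable function is measurable. -/
theorem measurable_modularCharacter : Measurable (fun g : G => (modularCharacter g : ℝ≥0)) := by
  obtain ⟨K⟩ : Nonempty (TopologicalSpace.PositiveCompacts G) := inferInstance
  set V := interior (K : Set G)
  have hV : MeasurableSet V := isOpen_interior.measurableSet
  have h0 : haar V ≠ 0 := (isOpen_interior.measure_pos haar K.interior_nonempty).ne'
  have ht : haar V ≠ ∞ := ((measure_mono interior_subset).trans_lt K.isCompact.measure_lt_top).ne
  have key (g : G) : (modularCharacter g : ℝ≥0) =
      ((∫⁻ x, V.indicator 1 (x * g) ∂(haar : Measure G)) / haar V).toNNReal := by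
    rw [lintegral_mul_right_eq_modularCharacter haar (measurable_one.indicator hV),
      lintegral_indicator_one hV, ENNReal.mul_div_cancel_right h0 ht, ENNReal.toNNReal_coe]
  simp_rw [key]
  refine (Measurable.div_const ?_ _).ennreal_toNNReal
  refine Measurable.lintegral_prod_left' (f := fun p : G × G => V.indicator 1 (p.1 * p.2)) ?_
  exact (measurable_one.indicator hV).comp measurable_mul

theorem measurable_modularFunction : Measurable (modularFunction : G → ℝ) :=
  (measurable_modularCharacter.comp measurable_inv).coe_nnreal_real

/-- For `g ∈ K`, the translate `V g⁻¹` stays inside the fixed compact set `L K⁻¹`, so `D(g)` times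
the measure of `V` is at most the measure of `L K⁻¹`. -/
theorem exists_modularCharacter_le_of_isCompact {K : Set G} (hK : IsCompact K) :
    ∃ C : ℝ≥0, ∀ g ∈ K, modularCharacter g ≤ C := by
  obtain ⟨L⟩ : Nonempty (TopologicalSpace.PositiveCompacts G) := inferInstance
  set V := interior (L : Set G)
  have hV : MeasurableSet V := isOpen_interior.measurableSet
  have h0 : haar V ≠ 0 := (isOpen_interior.measure_pos haar L.interior_nonempty).ne'
  have ht : haar V ≠ ∞ := ((measure_mono interior_subset).trans_lt L.isCompact.measure_lt_top).ne
  have hM : IsCompact ((fun p : G × G => p.1 * p.2⁻¹) '' ((L : Set G) ×ˢ K)) :=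
    (L.isCompact.prod hK).image (by fun_prop)
  set M := (fun p : G × G => p.1 * p.2⁻¹) '' ((L : Set G) ×ˢ K)
  refine ⟨(haar M / haar V).toNNReal, fun g hg => ?_⟩
  have hfin : haar M / haar V ≠ ∞ := ENNReal.div_ne_top hM.measure_lt_top.ne h0
  rw [← ENNReal.coe_le_coe, ENNReal.coe_toNNReal hfin, ENNReal.le_div_iff_mul_le (.inl h0) (.inl ht),
    ← lintegral_indicator_one hV,
    ← lintegral_mul_right_eq_modularCharacter haar (measurable_one.indicator hV)]
  calc ∫⁻ x, V.indicator 1 (x * g) ∂(haar : Measure G)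
      ≤ ∫⁻ x, M.indicator 1 x ∂(haar : Measure G) := by
        refine lintegral_mono fun x => ?_
        by_cases hx : x * g ∈ V
        · have : x ∈ M := ⟨(x * g, g), ⟨interior_subset hx, hg⟩, by simp⟩
          simp [this, hx]
        · simp [hx]
    _ ≤ haar M := lintegral_indicator_one_le M

/-- The image of `D μ` under inversion, where `D` is the modular character. -/
def modularInv (μ : Measure G) : Measure G :=
  (μ.withDensity fun x => (modularCharacter x : ℝ≥0)).map (·⁻¹)

theorem lintegral_modularInv (μ : Measure G) {f : G → ℝ≥0∞} (hf : Measurable f) :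
    ∫⁻ x, f x ∂(modularInv μ) = ∫⁻ x, modularCharacter x * f x⁻¹ ∂μ := by
  rw [modularInv, lintegral_map hf measurable_inv,
    lintegral_withDensity_eq_lintegral_mul _ measurable_modularCharacter.coe_nnreal_ennreal
      (g := fun x => f x⁻¹)
      (hf.comp measurable_inv)]
  rfl

theorem modularInv_modularInv (μ : Measure G) : modularInv (modularInv μ) = μ := by
  refine Measure.ext_of_lintegral _ fun f hf => ?_
  rw [lintegral_modularInv _ hf, lintegral_modularInv]
  · refine lintegral_congr fun x => ?_
    rw [← mul_assoc, ← ENNReal.coe_mul, modularCharacter_mul_inv, inv_inv]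
    simp
  · exact measurable_modularCharacter.coe_nnreal_ennreal.mul (hf.comp measurable_inv)

instance isMulLeftInvariant_modularInv (μ : Measure G) [μ.IsHaarMeasure] :
    (modularInv μ).IsMulLeftInvariant := by
  refine ⟨fun g => Measure.ext_of_lintegral _ fun f hf => ?_⟩
  have hm : Measurable fun x : G => (modularCharacter x : ℝ≥0∞) * f x⁻¹ :=
    measurable_modularCharacter.coe_nnreal_ennreal.mul (hf.comp measurable_inv)
  rw [lintegral_map hf (measurable_const_mul g), lintegral_modularInv _ hf,
    lintegral_modularInv _
      (f := fun x => f (g * x))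
      (hf.comp (measurable_const_mul g))]
  have h := lintegral_mul_right_eq_modularCharacter μ hm g⁻¹
  -- With `F(x) = D(x) f(x⁻¹)`, the integrand is `D(g) F(x g⁻¹)`; right translation by `g⁻¹` then
  -- contributes `D(g⁻¹)`, which cancels `D(g)`.
  have h2 : ∫⁻ x, modularCharacter x * f (g * x⁻¹) ∂μ =
      modularCharacter g * ∫⁻ x, modularCharacter (x * g⁻¹) * f (x * g⁻¹)⁻¹ ∂μ := by
    have hm' : Measurable fun x : G => (modularCharacter (x * g⁻¹) : ℝ≥0∞) * f (x * g⁻¹)⁻¹ :=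
      hm.comp (measurable_mul_const g⁻¹)
    rw [← lintegral_const_mul _ hm']
    refine lintegral_congr fun x => ?_
    have h3 : (modularCharacter g : ℝ≥0) * modularCharacter (x * g⁻¹) = modularCharacter x := by
      rw [map_mul, mul_left_comm, modularCharacter_mul_inv, mul_one]
    rw [← mul_assoc, ← ENNReal.coe_mul, h3, mul_inv_rev, inv_inv]
  refine h2.trans ?_
  rw [h, ← mul_assoc, ← ENNReal.coe_mul, modularCharacter_mul_inv]
  simp

instance isFiniteMeasureOnCompacts_modularInv [T2Space G] (μ : Measure G) [μ.IsHaarMeasure] :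
    IsFiniteMeasureOnCompacts (modularInv μ) := by
  refine ⟨fun K hK => ?_⟩
  obtain ⟨C, hC⟩ := exists_modularCharacter_le_of_isCompact hK.inv
  have hKm := hK.measurableSet
  rw [modularInv, map_apply measurable_inv hKm, withDensity_apply _ (measurable_inv hKm)]
  calc ∫⁻ x in (·⁻¹) ⁻¹' K, modularCharacter x ∂μ
      ≤ ∫⁻ x in (·⁻¹) ⁻¹' K, C ∂μ :=
        setLIntegral_mono measurable_const fun x hx => ENNReal.coe_le_coe.2 (hC x hx)
    _ = C * μ K⁻¹ := by rw [setLIntegral_const]; rfl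
    _ < ∞ := ENNReal.mul_lt_top ENNReal.coe_lt_top hK.inv.measure_lt_top

/-- By uniqueness of Haar measure `modularInv μ = c • μ`; since `modularInv` is an involution
commuting with scalars, `c² = 1`, and `c ≥ 0` forces `c = 1`. -/
theorem modularInv_eq_self [T2Space G] (μ : Measure G) [μ.IsHaarMeasure] : modularInv μ = μ := by
  have h := isMulLeftInvariant_eq_smul (modularInv μ) μ
  set c := haarScalarFactor (modularInv μ) μ
  have h2 : μ = (c * c) • μ := by
    have h3 : modularInv (c • μ) = c • modularInv μ := by
      refine Measure.ext_of_lintegral _ fun f hf => ?_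
      rw [lintegral_modularInv _ hf, lintegral_smul_measure, lintegral_smul_measure,
        lintegral_modularInv _ hf]
    calc μ = modularInv (c • μ) := by rw [← h, modularInv_modularInv]
      _ = (c * c) • μ := by rw [h3, mul_smul, ← h]
  have hc : c * c = 1 := by
    obtain ⟨K⟩ : Nonempty (TopologicalSpace.PositiveCompacts G) := inferInstance
    have h0 : μ K ≠ 0 := (measure_pos_of_nonempty_interior μ K.interior_nonempty).ne'
    have ht : μ K ≠ ∞ := K.isCompact.measure_lt_top.ne
    have h3 : 1 * μ K = ((c * c : ℝ≥0) : ℝ≥0∞) * μ K := by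
      conv_lhs => rw [h2]
      rw [one_mul]; rfl
    exact_mod_cast ((ENNReal.mul_left_inj h0 ht).1 h3).symm
  have hc1 : c = 1 := (pow_eq_one_iff_of_nonneg (zero_le (a := c)) two_ne_zero).1 (by rw [sq, hc])
  rw [h, hc1, one_smul]

/-- The inversion formula for a left Haar measure. -/
theorem lintegral_modularCharacter_mul_inv [T2Space G] (μ : Measure G) [μ.IsHaarMeasure]
    {f : G → ℝ≥0∞} (hf : Measurable f) :
    ∫⁻ x, modularCharacter x * f x⁻¹ ∂μ = ∫⁻ x, f x ∂μ := by
  rw [← lintegral_modularInv μ hf, modularInv_eq_self]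

end Modular

/-! ### Measures determined by Borel subsets of compact sets. -/

section CompactSubsets

variable {X : Type*} [TopologicalSpace X] [T2Space X] [SigmaCompactSpace X]
  [MeasurableSpace X] [BorelSpace X]

theorem measure_ext_of_subset_isCompact {m₁ m₂ : Measure X}
    (h : ∀ B K : Set X, MeasurableSet B → IsCompact K → B ⊆ K → m₁ B = m₂ B) : m₁ = m₂ := by
  refine ext_of_iUnion_eq_univ (iUnion_compactCovering X) fun n => ?_
  ext s hs
  rw [restrict_apply hs, restrict_apply hs]
  exact h _ _ (hs.inter (isCompact_compactCovering X n).measurableSet)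
    (isCompact_compactCovering X n) inter_subset_right

/-- Bochner integrals only see real-valued measures, which lose no information on subsets of compact
sets because both measures are finite there. -/
theorem measure_ext_of_integral_indicator {m₁ m₂ : Measure X} [IsFiniteMeasureOnCompacts m₁]
    [IsFiniteMeasureOnCompacts m₂] {a : ℂ} (ha : a ≠ 0)
    (h : ∀ B K : Set X, MeasurableSet B → IsCompact K → B ⊆ K →
      ∫ x, B.indicator (fun _ => a) x ∂m₁ = ∫ x, B.indicator (fun _ => a) x ∂m₂) : m₁ = m₂ := by
  refine measure_ext_of_subset_isCompact fun B K hB hK hBK => ?_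
  have := h B K hB hK hBK
  rw [integral_indicator_const _ hB, integral_indicator_const _ hB] at this
  have h3 := smul_left_injective ℝ ha this
  exact (measureReal_eq_measureReal_iff ((measure_mono hBK).trans_lt hK.measure_lt_top).ne
    ((measure_mono hBK).trans_lt hK.measure_lt_top).ne).1 h3

end CompactSubsets

/-! ### Right cosets: the product decomposition of `G` and the measure on `Γ\G`. -/

section

section RightCosetsAlgebra

variable {G : Type*} [Group G]

theorem rightCosets_mk_mul {Γ : Subgroup G} (ξ : Γ) (x : G) :
    (Quotient.mk (QuotientGroup.rightRel Γ) (ξ * x)) = Quotient.mk (QuotientGroup.rightRel Γ) x :=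
  Quotient.sound (QuotientGroup.rightRel_apply.2 (by simp))

theorem mul_inv_mem_of_rightCosets_mk_eq {Γ : Subgroup G} {x y : G}
    (h : Quotient.mk (QuotientGroup.rightRel Γ) y = Quotient.mk (QuotientGroup.rightRel Γ) x) :
    x * y⁻¹ ∈ Γ :=
  QuotientGroup.rightRel_apply.1 (Quotient.exact h)

theorem measurable_rightCosets_mk [MeasurableSpace G] {Γ : Subgroup G} :
    Measurable (Quotient.mk (QuotientGroup.rightRel Γ)) :=
  measurable_from_quotient.1 measurable_id

end RightCosetsAlgebra

section RightCosetsTopology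

variable {G : Type*} [Group G] [TopologicalSpace G] [IsTopologicalGroup G]

theorem t2Space_rightCosets [T2Space G] (Γ : Subgroup G) (hΓ : IsClosed (Γ : Set G)) :
    T2Space (RightCosets Γ) :=
  have := t2Space_leftCosets Γ hΓ
  (cosetInv Γ).symm.t2Space

theorem secondCountableTopology_rightCosets [SecondCountableTopology G] (Γ : Subgroup G) :
    SecondCountableTopology (RightCosets Γ) :=
  (cosetInv Γ).secondCountableTopology

theorem locallyCompactSpace_rightCosets [LocallyCompactSpace G] (Γ : Subgroup G) :
    LocallyCompactSpace (RightCosets Γ) :=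
  (cosetInv Γ).isClosedEmbedding.locallyCompactSpace

instance secondCountableTopology_subgroup [SecondCountableTopology G] (Γ : Subgroup G) :
    SecondCountableTopology Γ :=
  TopologicalSpace.Subtype.secondCountableTopology (Γ : Set G)

end RightCosetsTopology

variable {G : Type*} [Group G] [TopologicalSpace G] [IsTopologicalGroup G]
  [MeasurableSpace G] {Γ : Subgroup G} {τ : G ⧸ Γ → G}

theorem mk_rightSection (hτ : IsProperBorelSection Γ τ) (c : RightCosets Γ) :
    Quotient.mk (QuotientGroup.rightRel Γ) (rightSection Γ τ c) = c := by
  apply (cosetInv Γ).injective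
  rw [cosetInv_mk, rightSection, inv_inv, hτ.section_eq]

/-- The coordinate `ξ ∈ Γ` of `x = ξ γ (Γ x)`. -/
def rightCoord (hτ : IsProperBorelSection Γ τ) (x : G) : Γ :=
  ⟨x * (rightSection Γ τ (Quotient.mk _ x))⁻¹,
    mul_inv_mem_of_rightCosets_mk_eq (mk_rightSection hτ _)⟩

theorem rightCoord_mul_rightSection (hτ : IsProperBorelSection Γ τ) (x : G) :
    (rightCoord hτ x : G) * rightSection Γ τ (Quotient.mk _ x) = x := by
  simp [rightCoord]

theorem rightCoord_mul (hτ : IsProperBorelSection Γ τ) (η : Γ) (x : G) :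
    rightCoord hτ (η * x) = η * rightCoord hτ x := by
  ext
  simp [rightCoord, rightCosets_mk_mul, mul_assoc]

theorem rightCoord_rightSection (hτ : IsProperBorelSection Γ τ) (ξ : Γ) (c : RightCosets Γ) :
    rightCoord hτ (ξ * rightSection Γ τ c) = ξ := by
  ext
  simp [rightCoord, rightCosets_mk_mul, mk_rightSection hτ]

theorem isCompact_closure_image_rightSection (hτ : IsProperBorelSection Γ τ)
    {K : Set (RightCosets Γ)} (hK : IsCompact K) :
    IsCompact (closure (rightSection Γ τ '' K)) := by
  have h := (hτ.isCompact_closure_image _ (hK.image (cosetInv Γ).continuous)).inv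
  have h2 : rightSection Γ τ '' K = (τ '' (cosetInv Γ '' K))⁻¹ := by
    rw [← image_inv_eq_inv, image_image, image_image]; rfl
  rwa [h2, ← inv_closure]

/-- The points of `G` whose coset lies in `B` and whose `Γ`-coordinate lies in `A`. -/
def rightBox (hτ : IsProperBorelSection Γ τ) (B : Set (RightCosets Γ)) (A : Set Γ) : Set G :=
  {x | Quotient.mk _ x ∈ B ∧ rightCoord hτ x ∈ A}

theorem mul_rightSection_mem_rightBox (hτ : IsProperBorelSection Γ τ) {B : Set (RightCosets Γ)}
    {A : Set Γ} {ξ : Γ} {c : RightCosets Γ} :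
    (ξ : G) * rightSection Γ τ c ∈ rightBox hτ B A ↔ c ∈ B ∧ ξ ∈ A := by
  simp only [rightBox, mem_ofPred_eq, rightCoord_rightSection, rightCosets_mk_mul,
    mk_rightSection hτ]

/-- Properness of the section enters here: the box lies in the compact set `A · closure (γ(K))`. -/
theorem measure_rightBox_lt_top (hτ : IsProperBorelSection Γ τ) (μG : Measure G)
    [IsFiniteMeasureOnCompacts μG] {B K : Set (RightCosets Γ)} {A : Set Γ}
    (hK : IsCompact K) (hBK : B ⊆ K) (hA : IsCompact A) : μG (rightBox hτ B A) < ∞ := by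
  have hM : IsCompact ((fun p : G × G => p.1 * p.2) ''
      (((↑) '' A) ×ˢ closure (rightSection Γ τ '' K))) :=
    ((hA.image continuous_subtype_val).prod (isCompact_closure_image_rightSection hτ hK)).image
      continuous_mul
  refine (measure_mono fun x hx => ?_).trans_lt hM.measure_lt_top
  exact ⟨(rightCoord hτ x, rightSection Γ τ (Quotient.mk _ x)), ⟨mem_image_of_mem _ hx.2,
    subset_closure (mem_image_of_mem _ (hBK hx.1))⟩, rightCoord_mul_rightSection hτ x⟩

theorem rightFiberIntegral_indicator_rightBox (hτ : IsProperBorelSection Γ τ) (μΓ : Measure Γ)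
    {B : Set (RightCosets Γ)} {A : Set Γ} (hA : MeasurableSet A) (c : RightCosets Γ) :
    rightFiberIntegral Γ μΓ (rightSection Γ τ) ((rightBox hτ B A).indicator fun _ => 1) c =
      B.indicator (fun _ => (μΓ.real A : ℂ)) c := by
  classical
  simp only [rightFiberIntegral, indicator_apply, mul_rightSection_mem_rightBox]
  by_cases hc : c ∈ B
  · simp only [hc, true_and, if_true]
    have := integral_indicator_const (μ := μΓ) (1 : ℂ) hA
    simpa [indicator_apply] using this
  · simp [hc]

variable [BorelSpace G] [T2Space G] [LocallyCompactSpace G] [SecondCountableTopology G]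

theorem measurable_rightSection (hΓ : IsClosed (Γ : Set G)) (hτ : IsProperBorelSection Γ τ) :
    Measurable (rightSection Γ τ) := by
  have := borelSpace_rightCosets Γ hΓ
  have := borelSpace_leftCosets Γ hΓ
  exact (hτ.measurable.comp (cosetInv Γ).continuous.measurable).inv

theorem measurable_rightCoord (hΓ : IsClosed (Γ : Set G)) (hτ : IsProperBorelSection Γ τ) :
    Measurable (rightCoord hτ) :=
  (measurable_id.mul
    ((measurable_rightSection hΓ hτ).comp measurable_rightCosets_mk).inv).subtype_mk

theorem measurable_mul_rightSection (hΓ : IsClosed (Γ : Set G)) (hτ : IsProperBorelSection Γ τ) :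
    Measurable (fun p : RightCosets Γ × Γ => (p.2 : G) * rightSection Γ τ p.1) :=
  measurable_snd.subtype_val.mul ((measurable_rightSection hΓ hτ).comp measurable_fst)

theorem measurableSet_rightBox (hΓ : IsClosed (Γ : Set G)) (hτ : IsProperBorelSection Γ τ)
    {B : Set (RightCosets Γ)} {A : Set Γ} (hB : MeasurableSet B) (hA : MeasurableSet A) :
    MeasurableSet (rightBox hτ B A) :=
  (measurable_rightCosets_mk hB).inter (measurable_rightCoord hΓ hτ hA)

/-- As a function of `E`, the measure of the box over `B` is left invariant and finite on compacts,
hence proportional to `μΓ`. The cross-multiplied form eliminates the factor, which depends on `B`.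
-/
theorem measure_rightBox_mul (hΓ : IsClosed (Γ : Set G)) (hτ : IsProperBorelSection Γ τ)
    (μG : Measure G) [μG.IsHaarMeasure] (μΓ : Measure Γ) [μΓ.IsHaarMeasure]
    {B K : Set (RightCosets Γ)} {A E : Set Γ} (hK : IsCompact K) (hBK : B ⊆ K)
    (hA : MeasurableSet A) (hE : MeasurableSet E) :
    μG (rightBox hτ B E) * μΓ A = μG (rightBox hτ B A) * μΓ E := by
  have := locallyCompactSpace_subgroup Γ hΓ
  have hc := measurable_rightCoord hΓ hτ
  set m : Measure Γ := (μG.restrict (Quotient.mk _ ⁻¹' B)).map (rightCoord hτ) with hm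
  have hm_apply {E : Set Γ} (hE : MeasurableSet E) : m E = μG (rightBox hτ B E) := by
    rw [hm, map_apply hc hE, restrict_apply (hc hE), inter_comm]
    rfl
  have : m.IsMulLeftInvariant := by
    refine ⟨fun η => ?_⟩
    ext E hE
    rw [map_apply (measurable_const_mul η) hE, hm_apply hE,
      hm_apply (measurable_const_mul η hE), ← measure_preimage_mul μG (η : G) (rightBox hτ B E)]
    congr 1
    ext x
    simp [rightBox, rightCoord_mul, rightCosets_mk_mul]
  have : IsFiniteMeasureOnCompacts m := by
    refine ⟨fun L hL => ?_⟩
    rw [hm_apply hL.measurableSet]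
    exact measure_rightBox_lt_top hτ μG hK hBK hL
  rw [← hm_apply hA, ← hm_apply hE, isMulLeftInvariant_eq_smul m μΓ]
  simp only [Measure.smul_apply, ENNReal.smul_def, smul_eq_mul]
  ring

theorem exists_map_prod_eq (hΓ : IsClosed (Γ : Set G)) (hτ : IsProperBorelSection Γ τ)
    (μG : Measure G) [μG.IsHaarMeasure] (μΓ : Measure Γ) [μΓ.IsHaarMeasure] :
    ∃ μ : Measure (RightCosets Γ), IsFiniteMeasureOnCompacts μ ∧
      MeasurePreserving (fun p : RightCosets Γ × Γ => (p.2 : G) * rightSection Γ τ p.1)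
        (μ.prod μΓ) μG := by
  have := locallyCompactSpace_subgroup Γ hΓ
  have := borelSpace_rightCosets Γ hΓ
  have := t2Space_rightCosets Γ hΓ
  have := secondCountableTopology_rightCosets Γ
  have := locallyCompactSpace_rightCosets Γ
  obtain ⟨A⟩ : Nonempty (TopologicalSpace.PositiveCompacts Γ) := inferInstance
  have hA := A.isCompact.measurableSet
  have h0 : μΓ A ≠ 0 := (measure_pos_of_nonempty_interior μΓ A.interior_nonempty).ne'
  have ht : μΓ A ≠ ∞ := A.isCompact.measure_lt_top.ne
  have hc := measurable_rightCoord hΓ hτ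
  have hq := measurable_rightCosets_mk (Γ := Γ)
  -- The base measure of `B` is the measure of the box `B × A` divided by `μΓ A`; by proportionality
  -- the choice of the compact `A` with nonempty interior is immaterial.
  set μ : Measure (RightCosets Γ) :=
    (μΓ A)⁻¹ • (μG.restrict (rightCoord hτ ⁻¹' A)).map (Quotient.mk _) with hμ
  have hμ_apply {B : Set (RightCosets Γ)} (hB : MeasurableSet B) :
      μ B = (μΓ A)⁻¹ * μG (rightBox hτ B A) := by
    rw [hμ, Measure.smul_apply, map_apply hq hB, restrict_apply (hq hB)]
    rfl
  have hfin : IsFiniteMeasureOnCompacts μ := by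
    refine ⟨fun K hK => ?_⟩
    rw [hμ_apply hK.measurableSet]
    exact ENNReal.mul_lt_top (ENNReal.inv_lt_top.2 (pos_iff_ne_zero.2 h0))
      (measure_rightBox_lt_top hτ μG hK Subset.rfl A.isCompact)
  have hpair : Measurable fun x : G =>
      (Quotient.mk (QuotientGroup.rightRel Γ) x, rightCoord hτ x) := hq.prodMk hc
  have hprod : μ.prod μΓ = μG.map fun x => (Quotient.mk _ x, rightCoord hτ x) := by
    refine Measure.prod_eq fun B E hB hE => ?_
    -- Proportionality is known only over subsets of compact sets; comparing the two sides as
    -- measures on `Γ\G` extends it to every Borel `B`.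
    have hE_eq : (μG.restrict (rightCoord hτ ⁻¹' E)).map (Quotient.mk _) = μΓ E • μ := by
      refine measure_ext_of_subset_isCompact fun B K hB hK hBK => ?_
      rw [map_apply hq hB, restrict_apply (hq hB), Measure.smul_apply, hμ_apply hB, smul_eq_mul,
        mul_left_comm, mul_comm (μΓ E), ← measure_rightBox_mul hΓ hτ μG μΓ hK hBK hA hE,
        mul_left_comm, ENNReal.inv_mul_cancel h0 ht, mul_one]
      rfl
    have := congrArg (fun m => m B) hE_eq
    rw [map_apply hq hB, restrict_apply (hq hB), Measure.smul_apply, smul_eq_mul] at this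
    rw [map_apply hpair (hB.prod hE), mul_comm, ← this]
    rfl
  refine ⟨μ, hfin, measurable_mul_rightSection hΓ hτ, ?_⟩
  rw [hprod, map_map (measurable_mul_rightSection hΓ hτ) hpair]
  convert map_id
  ext x
  exact rightCoord_mul_rightSection hτ x

theorem isRightWeilMeasure_unique (hΓ : IsClosed (Γ : Set G)) (hτ : IsProperBorelSection Γ τ)
    (μG : Measure G) [μG.IsHaarMeasure] (μΓ : Measure Γ) [μΓ.IsHaarMeasure]
    {μ₁ μ₂ : Measure (RightCosets Γ)} (h₁ : IsRightWeilMeasure Γ μG μΓ (rightSection Γ τ) μ₁)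
    (h₂ : IsRightWeilMeasure Γ μG μΓ (rightSection Γ τ) μ₂) : μ₁ = μ₂ := by
  have := locallyCompactSpace_subgroup Γ hΓ
  have := borelSpace_rightCosets Γ hΓ
  have := t2Space_rightCosets Γ hΓ
  have := secondCountableTopology_rightCosets Γ
  have := locallyCompactSpace_rightCosets Γ
  have := h₁.regular
  have := h₂.regular
  obtain ⟨A⟩ : Nonempty (TopologicalSpace.PositiveCompacts Γ) := inferInstance
  have h0 : μΓ A ≠ 0 := (measure_pos_of_nonempty_interior μΓ A.interior_nonempty).ne'
  have ht : μΓ A ≠ ∞ := A.isCompact.measure_lt_top.ne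
  have ha : (μΓ.real A : ℂ) ≠ 0 := by
    simpa [Measure.real] using ENNReal.toReal_ne_zero.2 ⟨h0, ht⟩
  refine measure_ext_of_integral_indicator ha fun B K hB hK hBK => ?_
  have hA := A.isCompact.measurableSet
  have hint : Integrable ((rightBox hτ B A).indicator fun _ => (1 : ℂ)) μG :=
    (integrable_indicator_iff (measurableSet_rightBox hΓ hτ hB hA)).2
      (integrableOn_const (measure_rightBox_lt_top hτ μG hK hBK A.isCompact).ne)
  have e₁ := h₁.integral_eq _ hint
  rw [h₂.integral_eq _ hint] at e₁
  simpa only [rightFiberIntegral_indicator_rightBox hτ μΓ hA] using e₁.symm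

theorem isRightWeilMeasure_of_measurePreserving (hΓ : IsClosed (Γ : Set G))
    (μG : Measure G) (μΓ : Measure Γ) [SFinite μΓ]
    {μ : Measure (RightCosets Γ)} [IsFiniteMeasureOnCompacts μ]
    (h : MeasurePreserving (fun p : RightCosets Γ × Γ => (p.2 : G) * rightSection Γ τ p.1)
        (μ.prod μΓ) μG) : IsRightWeilMeasure Γ μG μΓ (rightSection Γ τ) μ := by
  have := borelSpace_rightCosets Γ hΓ
  have := t2Space_rightCosets Γ hΓ
  have := secondCountableTopology_rightCosets Γ
  have := locallyCompactSpace_rightCosets Γ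
  -- Regularity is automatic: `Γ\G` is locally compact, Hausdorff and second countable, and `μ` is
  -- finite on compacts.
  refine ⟨inferInstance, fun f hf => ?_⟩
  have hf' := h.integrable_comp_of_integrable hf
  rw [← h.map_eq, integral_map h.aemeasurable (h.map_eq.symm ▸ hf.1), integral_prod _ (by exact hf')]
  rfl

end

/-! ### Left cosets: coordinates `x = τ(xΓ) ξ` and boxes in `G`. -/

section LeftCosets

variable {G : Type*} [Group G] [TopologicalSpace G]
  [MeasurableSpace G] {Γ : Subgroup G} {τ : G ⧸ Γ → G}

/-- The coordinate `ξ ∈ Γ` of `x = τ (x Γ) ξ`. -/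
def leftCoord (hτ : IsProperBorelSection Γ τ) (x : G) : Γ :=
  ⟨(τ (QuotientGroup.mk x))⁻¹ * x, QuotientGroup.eq.1 (hτ.section_eq _)⟩

theorem section_mul_leftCoord (hτ : IsProperBorelSection Γ τ) (x : G) :
    τ (QuotientGroup.mk x) * leftCoord hτ x = x := by
  simp [leftCoord]

theorem mk_section_mul (hτ : IsProperBorelSection Γ τ) (c : G ⧸ Γ) (ξ : Γ) :
    (QuotientGroup.mk (τ c * ξ) : G ⧸ Γ) = c := by
  rw [QuotientGroup.mk_mul_of_mem _ ξ.2, hτ.section_eq]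

theorem leftCoord_section_mul (hτ : IsProperBorelSection Γ τ) (c : G ⧸ Γ) (ξ : Γ) :
    leftCoord hτ (τ c * ξ) = ξ := by
  ext
  simp only [leftCoord, mk_section_mul hτ, inv_mul_cancel_left]

/-- The points of `G` whose left coset lies in `B` and whose `Γ`-coordinate lies in `A`. -/
def leftBox (hτ : IsProperBorelSection Γ τ) (B : Set (G ⧸ Γ)) (A : Set Γ) : Set G :=
  {x | QuotientGroup.mk x ∈ B ∧ leftCoord hτ x ∈ A}

theorem section_mul_mem_leftBox (hτ : IsProperBorelSection Γ τ) {B : Set (G ⧸ Γ)}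
    {A : Set Γ} {ξ : Γ} {c : G ⧸ Γ} : τ c * ξ ∈ leftBox hτ B A ↔ c ∈ B ∧ ξ ∈ A := by
  simp only [leftBox, mem_ofPred_eq, leftCoord_section_mul, mk_section_mul hτ]

variable [IsTopologicalGroup G]

theorem exists_isCompact_leftBox_subset (hτ : IsProperBorelSection Γ τ) {B K : Set (G ⧸ Γ)}
    {A : Set Γ} (hK : IsCompact K) (hBK : B ⊆ K) (hA : IsCompact A) :
    ∃ M : Set G, IsCompact M ∧ leftBox hτ B A ⊆ M := by
  refine ⟨(fun p : G × G => p.1 * p.2) '' (closure (τ '' K) ×ˢ ((↑) '' A)),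
    ((hτ.isCompact_closure_image K hK).prod (hA.image continuous_subtype_val)).image
      continuous_mul, fun x hx => ?_⟩
  exact ⟨(τ (QuotientGroup.mk x), leftCoord hτ x), ⟨subset_closure (mem_image_of_mem _ (hBK hx.1)),
    mem_image_of_mem _ hx.2⟩, section_mul_leftCoord hτ x⟩

variable [BorelSpace G]

/-- Left invariance of `μΓ` lets the Borel representative `τ c` replace the arbitrary `Quotient.out
c`, which makes Fubini applicable. -/
theorem leftFiberIntegral_eq (hτ : IsProperBorelSection Γ τ) (μΓ : Measure Γ)
    [μΓ.IsMulLeftInvariant] (f : G → ℂ) (c : G ⧸ Γ) :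
    leftFiberIntegral Γ μΓ f c = ∫ ξ : Γ, f (τ c * ξ) ∂μΓ := by
  rw [← leftFiberIntegral_mk, hτ.section_eq]

theorem leftFiberIntegral_indicator_leftBox (hτ : IsProperBorelSection Γ τ) (μΓ : Measure Γ)
    [μΓ.IsMulLeftInvariant] {B : Set (G ⧸ Γ)} {A : Set Γ} (hA : MeasurableSet A) (c : G ⧸ Γ) :
    leftFiberIntegral Γ μΓ ((leftBox hτ B A).indicator fun _ => 1) c =
      B.indicator (fun _ => (μΓ.real A : ℂ)) c := by
  classical
  simp only [leftFiberIntegral_eq hτ, indicator_apply, section_mul_mem_leftBox]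
  by_cases hc : c ∈ B
  · simp only [hc, true_and, if_true]
    have := integral_indicator_const (μ := μΓ) (1 : ℂ) hA
    simpa [indicator_apply] using this
  · simp [hc]

variable [SecondCountableTopology G]

theorem measurable_leftCoord (hτ : IsProperBorelSection Γ τ) : Measurable (leftCoord hτ) :=
  ((hτ.measurable.comp QuotientGroup.measurable_coe).inv.mul measurable_id).subtype_mk

theorem measurableSet_leftBox (hτ : IsProperBorelSection Γ τ)
    {B : Set (G ⧸ Γ)} {A : Set Γ} (hB : MeasurableSet B) (hA : MeasurableSet A) :
    MeasurableSet (leftBox hτ B A) :=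
  (QuotientGroup.measurable_coe hB).inter (measurable_leftCoord hτ hA)

theorem measurable_section_mul (hτ : IsProperBorelSection Γ τ) :
    Measurable (fun p : (G ⧸ Γ) × Γ => τ p.1 * (p.2 : G)) :=
  (hτ.measurable.comp measurable_fst).mul measurable_snd.subtype_val

/-- The function `c ↦ ρ (τ c) Δ_G (τ c)` on `G ⧸ Γ`. -/
def rhoDensity [LocallyCompactSpace G] (τ : G ⧸ Γ → G) (ρ : G → ℝ) (c : G ⧸ Γ) : ℝ≥0 :=
  (ρ (τ c) * modularFunction (τ c)).toNNReal

variable [LocallyCompactSpace G]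

theorem measurable_rhoDensity (hτ : IsProperBorelSection Γ τ) {ρ : G → ℝ} (hρ : Continuous ρ) :
    Measurable (rhoDensity τ ρ) :=
  ((hρ.measurable.comp hτ.measurable).mul
    (measurable_modularFunction.comp hτ.measurable)).real_toNNReal

end LeftCosets

/-! ### Rho functions and the comparison of `Γ\G` with `G/Γ`. -/

/-- Inverting `ξ γ(c)` gives `τ(ε c) ξ⁻¹`, and the rho identity produces `Δ_Γ(ξ⁻¹) / Δ_G(ξ⁻¹)`. Its
denominator cancels the `G`-modular factor of `ξ`, leaving the modular character of `Γ`, exactly the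
weight needed to invert on `Γ`. -/
theorem IsRhoFunction.modularCharacter_mul_eq {G : Type*} [Group G] [TopologicalSpace G]
    [IsTopologicalGroup G] [LocallyCompactSpace G] {Γ : Subgroup G} [LocallyCompactSpace Γ]
    {hΓ : IsClosed (Γ : Set G)} {ρ : G → ℝ} (hρ : IsRhoFunction Γ hΓ ρ)
    (τ : G ⧸ Γ → G) (ξ : Γ) (c : RightCosets Γ) :
    modularCharacter (ξ * rightSection Γ τ c) * (ρ (ξ * rightSection Γ τ c)⁻¹).toNNReal =
      rhoDensity τ ρ (cosetInv Γ c) * modularCharacter ξ := by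
  have hinv : ((ξ : G) * rightSection Γ τ c)⁻¹ = τ (cosetInv Γ c) * (ξ⁻¹ : Γ) := by
    simp [rightSection]
  have hsub : subgroupModularFunction Γ hΓ ξ⁻¹ = (modularCharacter ξ : ℝ≥0) := by
    simp [subgroupModularFunction, modularFunction]
  have hG : modularFunction ((ξ⁻¹ : Γ) : G) = (modularCharacter (ξ : G) : ℝ≥0) := by
    simp [modularFunction]
  have hne : ((modularCharacter (ξ : G) : ℝ≥0) : ℝ) ≠ 0 :=
    NNReal.coe_ne_zero.2 (modularCharacterFun_pos _).ne'
  rw [hinv]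
  apply NNReal.coe_injective
  rw [NNReal.coe_mul, NNReal.coe_mul, rhoDensity, Real.coe_toNNReal _ (hρ.pos _).le,
    Real.coe_toNNReal _ (mul_pos (hρ.pos _) (modularFunction_pos _)).le, hρ.map_mul (τ (cosetInv Γ c)) ξ⁻¹, hsub, hG,
    _root_.map_mul, NNReal.coe_mul, modularFunction, rightSection]
  field_simp

variable {G : Type*} [Group G] [TopologicalSpace G] [IsTopologicalGroup G] [T2Space G]
  [LocallyCompactSpace G] [SecondCountableTopology G] [MeasurableSpace G] [BorelSpace G]
  {Γ : Subgroup G} {τ : G ⧸ Γ → G}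

theorem isRhoMeasure_unique (hΓ : IsClosed (Γ : Set G)) (hτ : IsProperBorelSection Γ τ)
    (μG : Measure G) [μG.IsHaarMeasure] (μΓ : Measure Γ) [μΓ.IsHaarMeasure]
    {ρ : G → ℝ} (hρ : Continuous ρ) {ν₁ ν₂ : Measure (G ⧸ Γ)}
    (h₁ : IsRhoMeasure Γ μG μΓ ρ ν₁) (h₂ : IsRhoMeasure Γ μG μΓ ρ ν₂) : ν₁ = ν₂ := by
  have := locallyCompactSpace_subgroup Γ hΓ
  have := borelSpace_leftCosets Γ hΓ
  have := t2Space_leftCosets Γ hΓ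
  have := h₁.regular
  have := h₂.regular
  obtain ⟨A⟩ : Nonempty (TopologicalSpace.PositiveCompacts Γ) := inferInstance
  have h0 : μΓ A ≠ 0 := (measure_pos_of_nonempty_interior μΓ A.interior_nonempty).ne'
  have ht : μΓ A ≠ ∞ := A.isCompact.measure_lt_top.ne
  have ha : (μΓ.real A : ℂ) ≠ 0 := by
    simpa [Measure.real] using ENNReal.toReal_ne_zero.2 ⟨h0, ht⟩
  refine measure_ext_of_integral_indicator ha fun B K hB hK hBK => ?_
  have hA := A.isCompact.measurableSet
  -- The box lies in a compact set, on which the continuous `ρ` is integrable.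
  have hint : Integrable (fun x => (leftBox hτ B A).indicator (fun _ => (1 : ℂ)) x * (ρ x : ℂ))
      μG := by
    obtain ⟨M, hM, hsub⟩ := exists_isCompact_leftBox_subset hτ hK hBK A.isCompact
    have hc : Continuous fun x => (ρ x : ℂ) := Complex.continuous_ofReal.comp hρ
    have h := (integrable_indicator_iff (measurableSet_leftBox hτ hB hA)).2
      ((hc.continuousOn.integrableOn_compact (μ := μG) hM).mono_set hsub)
    refine h.congr (Filter.Eventually.of_forall fun x => ?_)
    by_cases hx : x ∈ leftBox hτ B A <;> simp [hx]
  have e₁ := h₁.integral_eq _ hint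
  rw [h₂.integral_eq _ hint] at e₁
  simpa only [leftFiberIntegral_indicator_leftBox hτ μΓ hA] using e₁.symm

/-- The measure on `G ⧸ Γ` with density `ρ (τ c) Δ_G (τ c)` against the image of `μ` under
`cosetInv`. -/
def rhoMeasure (τ : G ⧸ Γ → G) (ρ : G → ℝ) (μ : Measure (RightCosets Γ)) : Measure (G ⧸ Γ) :=
  (μ.map (cosetInv Γ)).withDensity fun c => rhoDensity τ ρ c

theorem measurable_cosetInv (hΓ : IsClosed (Γ : Set G)) : Measurable (cosetInv Γ) := by
  have := borelSpace_rightCosets Γ hΓ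
  have := borelSpace_leftCosets Γ hΓ
  exact (cosetInv Γ).continuous.measurable

/-- The density is bounded on a compact `K`, since `τ(K)` has compact closure: `ρ` is bounded there
by continuity, and `Δ_G` by the bound for `D` on the inverse set. -/
theorem isFiniteMeasureOnCompacts_rhoMeasure (hΓ : IsClosed (Γ : Set G))
    (hτ : IsProperBorelSection Γ τ) {ρ : G → ℝ} (hρ : Continuous ρ)
    (μ : Measure (RightCosets Γ)) [IsFiniteMeasureOnCompacts μ] :
    IsFiniteMeasureOnCompacts (rhoMeasure τ ρ μ) := by
  have := t2Space_leftCosets Γ hΓ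
  have := borelSpace_leftCosets Γ hΓ
  refine ⟨fun K hK => ?_⟩
  have hKm := hK.measurableSet
  have hcl := hτ.isCompact_closure_image K hK
  obtain ⟨C₁, hC₁⟩ := exists_modularCharacter_le_of_isCompact hcl.inv
  obtain ⟨C₂, hC₂⟩ := (hcl.image hρ).bddAbove
  have hbound : ∀ c ∈ K, rhoDensity τ ρ c ≤ C₂.toNNReal * C₁ := fun c hc => by
    have hmem : τ c ∈ closure (τ '' K) := subset_closure (mem_image_of_mem _ hc)
    have h₁ : modularCharacter (τ c)⁻¹ ≤ C₁ := hC₁ _ (by simpa using hmem)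
    have h₂ : ρ (τ c) ≤ C₂ := hC₂ (mem_image_of_mem _ hmem)
    rw [rhoDensity, mul_comm, Real.toNNReal_mul (modularFunction_pos _).le, mul_comm]
    refine mul_le_mul' (Real.toNNReal_le_toNNReal h₂) ?_
    rwa [modularFunction, Real.toNNReal_coe]
  rw [rhoMeasure, withDensity_apply _ hKm]
  calc ∫⁻ c in K, rhoDensity τ ρ c ∂(μ.map (cosetInv Γ))
      ≤ ∫⁻ _ in K, (C₂.toNNReal * C₁ : ℝ≥0) ∂(μ.map (cosetInv Γ)) :=
        setLIntegral_mono measurable_const fun c hc => ENNReal.coe_le_coe.2 (hbound c hc)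
    _ = (C₂.toNNReal * C₁ : ℝ≥0) * μ (cosetInv Γ ⁻¹' K) := by
        rw [setLIntegral_const, map_apply (measurable_cosetInv hΓ) hKm]
    _ < ∞ := ENNReal.mul_lt_top ENNReal.coe_lt_top
        ((cosetInv Γ).isCompact_preimage.2 hK).measure_lt_top

theorem measurePreserving_section_mul (hΓ : IsClosed (Γ : Set G)) (hτ : IsProperBorelSection Γ τ)
    (μG : Measure G) [μG.IsHaarMeasure] (μΓ : Measure Γ) [μΓ.IsHaarMeasure]
    {μ : Measure (RightCosets Γ)} [SFinite μ]
    (h : MeasurePreserving (fun p : RightCosets Γ × Γ => (p.2 : G) * rightSection Γ τ p.1)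
        (μ.prod μΓ) μG) {ρ : G → ℝ} (hρ : IsRhoFunction Γ hΓ ρ) :
    MeasurePreserving (fun p : (G ⧸ Γ) × Γ => τ p.1 * (p.2 : G))
      ((rhoMeasure τ ρ μ).prod μΓ) (μG.withDensity fun x => (ρ x).toNNReal) := by
  have := locallyCompactSpace_subgroup Γ hΓ
  have hε := measurable_cosetInv hΓ
  have : SFinite (rhoMeasure τ ρ μ) := by unfold rhoMeasure; infer_instance
  have hd := measurable_rhoDensity hτ hρ.continuous
  have hm := measurable_section_mul hτ
  refine ⟨hm, Measure.ext_of_lintegral _ fun f hf => ?_⟩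
  have hfm : Measurable fun p : (G ⧸ Γ) × Γ => f (τ p.1 * (p.2 : G)) := hf.comp hm
  have hin : Measurable fun c : G ⧸ Γ => ∫⁻ ξ : Γ, f (τ c * ξ) ∂μΓ := hfm.lintegral_prod_right'
  have hρm : Measurable fun x : G => ((ρ x).toNNReal : ℝ≥0∞) :=
    hρ.continuous.measurable.real_toNNReal.coe_nnreal_ennreal
  have hF : Measurable fun x : G =>
      (modularCharacter x : ℝ≥0∞) * ((ρ x⁻¹).toNNReal * f x⁻¹) :=
    measurable_modularCharacter.coe_nnreal_ennreal.mul ((hρm.mul hf).comp measurable_inv)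
  calc ∫⁻ x, f x ∂(((rhoMeasure τ ρ μ).prod μΓ).map fun p => τ p.1 * (p.2 : G))
      = ∫⁻ c, rhoDensity τ ρ c * ∫⁻ ξ : Γ, f (τ c * ξ) ∂μΓ ∂(μ.map (cosetInv Γ)) := by
        rw [lintegral_map hf hm, lintegral_prod _ hfm.aemeasurable, rhoMeasure,
          lintegral_withDensity_eq_lintegral_mul _ hd.coe_nnreal_ennreal hin]
        rfl
    _ = ∫⁻ c, rhoDensity τ ρ (cosetInv Γ c) * ∫⁻ ξ : Γ, f (τ (cosetInv Γ c) * ξ) ∂μΓ ∂μ :=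
        lintegral_map (hd.coe_nnreal_ennreal.mul hin) hε
    _ = ∫⁻ c, ∫⁻ ξ : Γ, (fun x : G => (modularCharacter x : ℝ≥0∞) *
          ((ρ x⁻¹).toNNReal * f x⁻¹)) (ξ * rightSection Γ τ c) ∂μΓ ∂μ := by
        refine lintegral_congr fun c => ?_
        have hg : Measurable fun ξ : Γ => f (τ (cosetInv Γ c) * ξ) :=
          hf.comp (measurable_subtype_coe.const_mul _)
        have hg' : Measurable fun ξ : Γ =>
            (modularCharacter ξ : ℝ≥0∞) * f (τ (cosetInv Γ c) * (ξ⁻¹ : Γ)) :=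
          measurable_modularCharacter.coe_nnreal_ennreal.mul (hg.comp measurable_inv)
        -- Inversion on the fibre `Γ`, replacing `ξ` by `ξ⁻¹` at the cost of the weight `D_Γ(ξ)`.
        rw [← lintegral_modularCharacter_mul_inv μΓ hg, ← lintegral_const_mul _ hg']
        refine lintegral_congr fun ξ => ?_
        have hinv : ((ξ : G) * rightSection Γ τ c)⁻¹ = τ (cosetInv Γ c) * (ξ⁻¹ : Γ) := by
          simp [rightSection]
        beta_reduce
        rw [← mul_assoc, ← mul_assoc, ← ENNReal.coe_mul, ← ENNReal.coe_mul,
          hρ.modularCharacter_mul_eq τ ξ c, hinv]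
    -- The product decomposition for right cosets reassembles the integral over `G`; inversion on
    -- `G` then removes the modular weight.
    _ = ∫⁻ x, modularCharacter x * ((ρ x⁻¹).toNNReal * f x⁻¹) ∂μG :=
        (lintegral_prod _ (hF.comp h.measurable).aemeasurable).symm.trans (h.lintegral_comp hF)
    _ = ∫⁻ x, (ρ x).toNNReal * f x ∂μG :=
        lintegral_modularCharacter_mul_inv μG (hρm.mul hf)
    _ = ∫⁻ x, f x ∂μG.withDensity fun x => (ρ x).toNNReal :=
        (lintegral_withDensity_eq_lintegral_mul _ hρm hf).symm

theorem isRhoMeasure_rhoMeasure (hΓ : IsClosed (Γ : Set G)) (hτ : IsProperBorelSection Γ τ)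
    (μG : Measure G) [μG.IsHaarMeasure] (μΓ : Measure Γ) [μΓ.IsHaarMeasure]
    {μ : Measure (RightCosets Γ)} [SFinite μ] [IsFiniteMeasureOnCompacts μ]
    (h : MeasurePreserving (fun p : RightCosets Γ × Γ => (p.2 : G) * rightSection Γ τ p.1)
        (μ.prod μΓ) μG) {ρ : G → ℝ} (hρ : IsRhoFunction Γ hΓ ρ) :
    IsRhoMeasure Γ μG μΓ ρ (rhoMeasure τ ρ μ) := by
  have := locallyCompactSpace_subgroup Γ hΓ
  have := borelSpace_leftCosets Γ hΓ
  have := t2Space_leftCosets Γ hΓ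
  have := isFiniteMeasureOnCompacts_rhoMeasure hΓ hτ hρ.continuous μ
  have h' := measurePreserving_section_mul hΓ hτ μG μΓ h hρ
  have hρm : Measurable fun x : G => (ρ x).toNNReal := hρ.continuous.measurable.real_toNNReal
  refine ⟨inferInstance, fun f hf => ?_⟩
  have hsmul (x : G) : (ρ x).toNNReal • f x = f x * (ρ x : ℂ) := by
    rw [NNReal.smul_def, Real.coe_toNNReal _ (hρ.pos x).le, Complex.real_smul, mul_comm]
  have hf₁ : Integrable f (μG.withDensity fun x => (ρ x).toNNReal) := by
    rw [integrable_withDensity_iff_integrable_smul hρm]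
    simpa only [hsmul] using hf
  have hf₂ := h'.integrable_comp_of_integrable hf₁
  calc ∫ x, f x * (ρ x : ℂ) ∂μG = ∫ x, f x ∂μG.withDensity fun x => (ρ x).toNNReal := by
        rw [integral_withDensity_eq_integral_smul hρm]
        simp only [hsmul]
    _ = ∫ p : (G ⧸ Γ) × Γ, f (τ p.1 * p.2) ∂(rhoMeasure τ ρ μ).prod μΓ := by
        rw [← h'.map_eq, integral_map h'.aemeasurable (h'.map_eq.symm ▸ hf₁.1)]
    _ = ∫ c, leftFiberIntegral Γ μΓ f c ∂rhoMeasure τ ρ μ := by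
        rw [integral_prod _ (by exact hf₂)]
        simp only [leftFiberIntegral_eq hτ]

/-- The factor in the integrand is the reciprocal of the strictly positive density of `rhoMeasure`,
so only transport along the homeomorphism `ε` remains. -/
theorem integrable_and_integral_eq_rhoMeasure (hΓ : IsClosed (Γ : Set G))
    (hτ : IsProperBorelSection Γ τ) {ρ : G → ℝ} (hρ : IsRhoFunction Γ hΓ ρ)
    {μ : Measure (RightCosets Γ)} {f : RightCosets Γ → ℂ} (hf : Integrable f μ) :
    Integrable (fun c : G ⧸ Γ => f ((cosetInv Γ).symm c) *
        ((1 / (ρ (τ c) * modularFunction (τ c)) : ℝ) : ℂ)) (rhoMeasure τ ρ μ) ∧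
      ∫ c, f c ∂μ = ∫ c : G ⧸ Γ, f ((cosetInv Γ).symm c) *
        ((1 / (ρ (τ c) * modularFunction (τ c)) : ℝ) : ℂ) ∂rhoMeasure τ ρ μ := by
  have := borelSpace_rightCosets Γ hΓ
  have := borelSpace_leftCosets Γ hΓ
  have hd := measurable_rhoDensity hτ hρ.continuous
  have hemb : MeasurableEmbedding (cosetInv Γ) := (cosetInv Γ).measurableEmbedding
  have hsmul (c : G ⧸ Γ) : rhoDensity τ ρ c • (f ((cosetInv Γ).symm c) *
      ((1 / (ρ (τ c) * modularFunction (τ c)) : ℝ) : ℂ)) = f ((cosetInv Γ).symm c) := by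
    have hpos := mul_pos (hρ.pos (τ c)) (modularFunction_pos (τ c))
    rw [NNReal.smul_def, rhoDensity, Real.coe_toNNReal _ hpos.le, Complex.real_smul,
      mul_left_comm, ← Complex.ofReal_mul, mul_one_div_cancel hpos.ne', Complex.ofReal_one, mul_one]
  rw [rhoMeasure, integrable_withDensity_iff_integrable_smul hd,
    integral_withDensity_eq_integral_smul hd]
  simp only [hsmul]
  rw [hemb.integrable_map_iff, hemb.integral_map]
  simpa [Function.comp_def] using hf

theorem measurable_rightFiberIntegral (hΓ : IsClosed (Γ : Set G)) (hτ : IsProperBorelSection Γ τ)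
    (μΓ : Measure Γ) [SFinite μΓ] {f : G → ℂ} (hf : Measurable f) :
    Measurable (rightFiberIntegral Γ μΓ (rightSection Γ τ) f) :=
  (hf.comp (measurable_mul_rightSection hΓ hτ)).stronglyMeasurable.integral_prod_right'.measurable

end CosetWeil

end

theorem mainTheorem5 {G : Type*} [Group G] [TopologicalSpace G] [IsTopologicalGroup G]
    [T2Space G] [LocallyCompactSpace G] [SecondCountableTopology G]
    [MeasurableSpace G] [BorelSpace G]
    (Γ : Subgroup G) (hΓ : IsClosed (Γ : Set G))
    (μG : Measure G) [μG.IsHaarMeasure] (μΓ : Measure Γ) [μΓ.IsHaarMeasure]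
    (τ : G ⧸ Γ → G) (hτ : CosetWeil.IsProperBorelSection Γ τ) :
    -- existence and uniqueness
    (∃! μ : Measure (CosetWeil.RightCosets Γ),
      CosetWeil.IsRightWeilMeasure Γ μG μΓ (CosetWeil.rightSection Γ τ) μ) ∧
    ∀ μ : Measure (CosetWeil.RightCosets Γ),
      CosetWeil.IsRightWeilMeasure Γ μG μΓ (CosetWeil.rightSection Γ τ) μ →
      -- integrability of almost every fibre, and of the fibre integral
      (∀ f : G → ℂ, Integrable f μG →
        (∀ᵐ c ∂μ, Integrable (fun ξ : Γ => f (ξ * CosetWeil.rightSection Γ τ c)) μΓ) ∧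
        Integrable (CosetWeil.rightFiberIntegral Γ μΓ (CosetWeil.rightSection Γ τ) f) μ ∧
        (Measurable f →
          Measurable (CosetWeil.rightFiberIntegral Γ μΓ (CosetWeil.rightSection Γ τ) f))) ∧
      -- the formula in terms of the quasi-invariant measure of a rho function
      ∀ ρ : G → ℝ, CosetWeil.IsRhoFunction Γ hΓ ρ →
        (∃! ν : Measure (G ⧸ Γ), CosetWeil.IsRhoMeasure Γ μG μΓ ρ ν) ∧
        ∀ ν : Measure (G ⧸ Γ), CosetWeil.IsRhoMeasure Γ μG μΓ ρ ν →
          ∀ f : CosetWeil.RightCosets Γ → ℂ, Integrable f μ →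
            Integrable (fun c : G ⧸ Γ => f ((CosetWeil.cosetInv Γ).symm c) *
              ((1 / (ρ (τ c) * CosetWeil.modularFunction (τ c)) : ℝ) : ℂ)) ν ∧
            ∫ c, f c ∂μ = ∫ c : G ⧸ Γ, f ((CosetWeil.cosetInv Γ).symm c) *
              ((1 / (ρ (τ c) * CosetWeil.modularFunction (τ c)) : ℝ) : ℂ) ∂ν := by
  open CosetWeil in
  have := locallyCompactSpace_subgroup Γ hΓ
  have := borelSpace_rightCosets Γ hΓ
  have := t2Space_rightCosets Γ hΓ
  have := secondCountableTopology_rightCosets Γ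
  have := locallyCompactSpace_rightCosets Γ
  obtain ⟨μ₀, hfin, hmp⟩ := exists_map_prod_eq hΓ hτ μG μΓ
  have hμ₀ := isRightWeilMeasure_of_measurePreserving hΓ μG μΓ hmp
  refine ⟨⟨μ₀, hμ₀, fun μ hμ => isRightWeilMeasure_unique hΓ hτ μG μΓ hμ hμ₀⟩, fun μ hμ => ?_⟩
  -- By uniqueness any such measure is the constructed one, so the product decomposition `hmp` is
  -- available for it.
  obtain rfl := isRightWeilMeasure_unique hΓ hτ μG μΓ hμ hμ₀
  refine ⟨fun f hf => ?_, fun ρ hρ => ?_⟩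
  · have hf' := hmp.integrable_comp_of_integrable hf
    exact ⟨hf'.prod_right_ae, hf'.integral_prod_left, measurable_rightFiberIntegral hΓ hτ μΓ⟩
  · have hν₀ := isRhoMeasure_rhoMeasure hΓ hτ μG μΓ hmp hρ
    refine ⟨⟨_, hν₀, fun ν hν => isRhoMeasure_unique hΓ hτ μG μΓ hρ.continuous hν hν₀⟩,
      fun ν hν f hf => ?_⟩
    rw [isRhoMeasure_unique hΓ hτ μG μΓ hρ.continuous hν hν₀]
    exact integrable_and_integral_eq_rhoMeasure hΓ hτ hρ hf
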